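/- Let $1\le p<\infty$, $p\ne 2$, and let $H^p$ be the Hardy space of the open unit disc $D$: the analytic functions $f$ on $D$ with $\|f\|_p=\sup_{0<r<1}\left(\int_T|f(r\zeta)|^p\,dm(\zeta)\right)^{1/p}<\infty$, where $m$ is normalized Lebesgue measure on the unit circle $T$. Let $\mathbb A$ be the group of automorphisms $\phi(z)=\frac{\lambda(z-a)}{1-\overline a z}$ of $D$, with $a\in D$ and $|\lambda|=1$. For such a $\phi$ put $U_\phi f=(\overline\lambda\,\phi')^{1/p}\,(f\circ\phi)$ (principal branch of the power), and for $\psi\in\mathbb A$ let $M_\psi f=\psi f$. An isometry $S$ of $H^p$ into itself whose range has codimension one is called Crownover if $\bigcap_{n=1}^\infty S^nH^p=(0)$. An automorphism $\phi\in\mathbb A$ other than the identity is called hyperbolic if it has two distinct fixed points on $T$; $\phi_n$ denotes the $n$-fold composition of $\phi$ with itself. Proposition 4. Let $\phi\in\mathbb A$ be hyperbolic and let $\psi\in\mathbb A$ be arbitrary. Then $\sum_{n=0}^\infty(1-|\phi_n(c)|)<\infty$ for every $c\in D$, and $M_\psi U_\phi$ is an isometry of $H^p$ into itself of codimension one which is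 not Crownover; that is, $\bigcap_{n=1}^\infty (M_\psi U_\phi)^nH^p\ne(0)$. -/

import Mathlib

open MeasureTheory
open scoped ENNReal ComplexConjugate Complex.UnitDisc

noncomputable section

namespace HardyDisc

/-! ### The Hardy spaces of the unit disc -/

/-- `f : 𝔻 → ℂ` is analytic on the open unit disc. -/
def IsAnalytic (f : 𝔻 → ℂ) : Prop :=
  ∃ F : ℂ → ℂ, DifferentiableOn ℂ F (Metric.ball 0 1) ∧ ∀ z : 𝔻, f z = F z

lemma IsAnalytic.continuous {f : 𝔻 → ℂ} (hf : IsAnalytic f) : Continuous f := by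
  obtain ⟨F, hF, h⟩ := hf
  have : f = fun z : 𝔻 => F z := funext h
  rw [this]
  exact hF.continuousOn.comp_continuous Complex.UnitDisc.continuous_coe
    (fun z => by simpa using z.norm_lt_one)

/-- The point `r * exp (i θ)` of the disc, for `0 < r < 1`. -/
def circlePt (r : Set.Ioo (0 : ℝ) 1) (θ : ℝ) : 𝔻 :=
  Complex.UnitDisc.mk (circleMap 0 r θ) (by
    simpa [abs_of_pos r.2.1] using r.2.2)

lemma continuous_circlePt (r : Set.Ioo (0 : ℝ) 1) : Continuous (circlePt r) :=
  Complex.UnitDisc.isEmbedding_coe.continuous_iff.2 (continuous_circleMap 0 r)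

/-- Normalized Lebesgue measure on the unit circle, in the angular coordinate
`θ ∈ (0, 2π]`. -/
def circleMeasure : Measure ℝ :=
  ENNReal.ofReal (2 * Real.pi)⁻¹ • volume.restrict (Set.Ioc 0 (2 * Real.pi))

/-- `(∫_T |f(rζ)|^p dm(ζ))^(1/p)`. -/
def circleNorm (p : ℝ≥0∞) (f : 𝔻 → ℂ) (r : Set.Ioo (0 : ℝ) 1) : ℝ≥0∞ :=
  eLpNorm (fun θ => f (circlePt r θ)) p circleMeasure

/-- The `H^p` norm `sup_{0<r<1} (∫_T |f(rζ)|^p dm(ζ))^(1/p)`, with values in `[0, ∞]`. -/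
def hardyENorm (p : ℝ≥0∞) (f : 𝔻 → ℂ) : ℝ≥0∞ :=
  ⨆ r : Set.Ioo (0 : ℝ) 1, circleNorm p f r

lemma hardyENorm_add_le {p : ℝ≥0∞} (hp : 1 ≤ p) {f g : 𝔻 → ℂ}
    (hf : Continuous f) (hg : Continuous g) :
    hardyENorm p (f + g) ≤ hardyENorm p f + hardyENorm p g := by
  refine iSup_le fun r => ?_
  refine (eLpNorm_add_le (f := fun θ => f (circlePt r θ)) (g := fun θ => g (circlePt r θ))
    (hf.comp (continuous_circlePt r)).aestronglyMeasurable
    (hg.comp (continuous_circlePt r)).aestronglyMeasurable hp).trans ?_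
  exact add_le_add (le_iSup (circleNorm p f) r) (le_iSup (circleNorm p g) r)

lemma hardyENorm_smul (p : ℝ≥0∞) (c : ℂ) (f : 𝔻 → ℂ) :
    hardyENorm p (c • f) = ‖c‖ₑ * hardyENorm p f := by
  unfold hardyENorm
  rw [ENNReal.mul_iSup]
  exact iSup_congr fun r => eLpNorm_const_smul c (fun θ => f (circlePt r θ)) p circleMeasure

lemma hardyENorm_zero (p : ℝ≥0∞) : hardyENorm p 0 = 0 := by
  simpa using hardyENorm_smul p 0 0

lemma exists_circlePt (z : 𝔻) (hz : z ≠ 0) :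
    ∃ r, ∃ θ ∈ Set.Ioc 0 (2 * Real.pi), circlePt r θ = z := by
  have h0 : 0 < ‖(z : ℂ)‖ := by simpa using hz
  refine ⟨⟨‖(z : ℂ)‖, h0, z.norm_lt_one⟩, ?_⟩
  have hmem : (z : ℂ) ∈ circleMap 0 ‖(z : ℂ)‖ '' Set.Ioc 0 (2 * Real.pi) := by
    rw [image_circleMap_Ioc]
    simp
  obtain ⟨θ, hθ, h⟩ := hmem
  exact ⟨θ, hθ, Complex.UnitDisc.coe_injective h⟩

lemma eq_zero_of_hardyENorm {p : ℝ≥0∞} (hp : 1 ≤ p) {f : 𝔻 → ℂ} (hf : Continuous f)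
    (h : hardyENorm p f = 0) : f = 0 := by
  have key : ∀ z : 𝔻, z ≠ 0 → f z = 0 := by
    intro z hz
    obtain ⟨r, θ, hθ, rfl⟩ := exists_circlePt z hz
    have hc : Continuous fun θ => f (circlePt r θ) := hf.comp (continuous_circlePt r)
    have h1 : circleNorm p f r = 0 :=
      le_antisymm (h ▸ le_iSup (circleNorm p f) r) bot_le
    have h2 := (eLpNorm_eq_zero_iff hc.aestronglyMeasurable
      (zero_lt_one.trans_le hp).ne').1 h1
    have h3 : (fun θ => f (circlePt r θ)) =ᵐ[volume.restrict (Set.Ioc 0 (2 * Real.pi))]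
        (fun _ => (0 : ℂ)) := by
      refine (Measure.ae_ennreal_smul_measure_iff ?_).1 h2
      simp [Real.pi_pos]
    exact Measure.eqOn_Ioc_of_ae_eq volume h3 hc.continuousOn continuousOn_const hθ
  have hset : Set.EqOn f 0 (closure {z : 𝔻 | z ≠ 0}) :=
    Set.EqOn.closure (fun z hz => key z hz) hf continuous_const
  have hcl : (0 : 𝔻) ∈ closure {z : 𝔻 | z ≠ 0} := by
    have ht : Filter.Tendsto (fun n : ℕ => Complex.UnitDisc.mk (1 / ((n : ℂ) + 2)) (by
        have h4 : (0 : ℝ) < (n : ℝ) + 2 := by positivity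
        have h5 : ‖(n : ℂ) + 2‖ = (n : ℝ) + 2 := by
          rw [← Complex.ofReal_natCast, ← Complex.ofReal_ofNat, ← Complex.ofReal_add,
            Complex.norm_real, Real.norm_of_nonneg h4.le]
        rw [norm_div, norm_one, h5, div_lt_one h4]
        have : (0 : ℝ) ≤ n := n.cast_nonneg
        linarith)) Filter.atTop (nhds (0 : 𝔻)) := by
      rw [Complex.UnitDisc.isEmbedding_coe.tendsto_nhds_iff]
      have h6 := (tendsto_one_div_add_atTop_nhds_zero_nat (𝕜 := ℂ)).comp
        (Filter.tendsto_add_atTop_nat 1)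
      refine h6.congr fun n => ?_
      simp only [Function.comp, Complex.UnitDisc.coe_mk]
      push_cast
      ring
    refine mem_closure_of_tendsto ht (Filter.Eventually.of_forall fun n => ?_)
    have h7 : (n : ℂ) + 2 ≠ 0 := by
      have : ((n + 2 : ℕ) : ℂ) ≠ 0 := Nat.cast_ne_zero.2 (by omega)
      simpa using this
    simpa using h7
  funext z
  by_cases hz : z = 0
  · rw [hz]; exact hset hcl
  · exact key z hz

/-- The analytic functions on the disc with finite `H^p` norm, as a subspace of all
functions on the disc. -/
def hardySubmodule (p : ℝ≥0∞) [hp : Fact (1 ≤ p)] : Submodule ℂ (𝔻 → ℂ) where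
  carrier := {f | IsAnalytic f ∧ hardyENorm p f < ∞}
  zero_mem' := ⟨⟨0, differentiableOn_const 0, fun _ => rfl⟩, by
    rw [hardyENorm_zero]; exact ENNReal.zero_lt_top⟩
  add_mem' := by
    rintro f g ⟨hf, hf'⟩ ⟨hg, hg'⟩
    refine ⟨?_, (hardyENorm_add_le hp.out hf.continuous hg.continuous).trans_lt
      (ENNReal.add_lt_top.2 ⟨hf', hg'⟩)⟩
    obtain ⟨F, hF, h⟩ := hf
    obtain ⟨G, hG, h'⟩ := hg
    exact ⟨F + G, hF.add hG, fun z => by simp [h, h']⟩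
  smul_mem' := by
    rintro c f ⟨hf, hf'⟩
    refine ⟨?_, by
      rw [hardyENorm_smul]; exact ENNReal.mul_lt_top enorm_lt_top hf'⟩
    obtain ⟨F, hF, h⟩ := hf
    exact ⟨c • F, hF.const_smul c, fun z => by simp [h]⟩

/-- The Hardy space `H^p` of the unit disc. -/
def Hardy (p : ℝ≥0∞) [Fact (1 ≤ p)] : Type := hardySubmodule p

variable {p : ℝ≥0∞} [Fact (1 ≤ p)]

instance : AddCommGroup (Hardy p) := inferInstanceAs (AddCommGroup (hardySubmodule p))

instance : Module ℂ (Hardy p) := inferInstanceAs (Module ℂ (hardySubmodule p))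

instance : CoeFun (Hardy p) (fun _ => 𝔻 → ℂ) := ⟨fun f => (f : hardySubmodule p).1⟩

instance : Norm (Hardy p) := ⟨fun f => (hardyENorm p f).toReal⟩

lemma Hardy.norm_smul' (c : ℂ) (f : Hardy p) : ‖c • f‖ = ‖c‖ * ‖f‖ := by
  change (hardyENorm p (c • (f : 𝔻 → ℂ))).toReal = _
  rw [hardyENorm_smul, ENNReal.toReal_mul, toReal_enorm]
  rfl

/-- The norm of `H^p`, as a group norm. -/
def hardyGroupNorm (p : ℝ≥0∞) [hp : Fact (1 ≤ p)] : AddGroupNorm (Hardy p) where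
  toFun f := ‖f‖
  map_zero' := by
    change (hardyENorm p 0).toReal = 0
    rw [hardyENorm_zero, ENNReal.toReal_zero]
  add_le' f g := by
    change (hardyENorm p ((f : 𝔻 → ℂ) + (g : 𝔻 → ℂ))).toReal ≤
      (hardyENorm p f).toReal + (hardyENorm p g).toReal
    rw [← ENNReal.toReal_add f.2.2.ne g.2.2.ne]
    exact ENNReal.toReal_mono (ENNReal.add_lt_top.2 ⟨f.2.2, g.2.2⟩).ne
      (hardyENorm_add_le hp.out f.2.1.continuous g.2.1.continuous)
  neg' f := by
    have := Hardy.norm_smul' (-1) f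
    simpa using this
  eq_zero_of_map_eq_zero' f h := by
    have h' : hardyENorm p f = 0 :=
      ((ENNReal.toReal_eq_zero_iff _).1 h).resolve_right f.2.2.ne
    exact Subtype.ext (eq_zero_of_hardyENorm hp.out f.2.1.continuous h')

instance : NormedAddCommGroup (Hardy p) := (hardyGroupNorm p).toNormedAddCommGroup

instance : NormedSpace ℂ (Hardy p) := ⟨fun c f => (Hardy.norm_smul' c f).le⟩

/-! ### Automorphisms of the disc -/

/-- A holomorphic automorphism `φ(z) = lam * (z - a) / (1 - conj a * z)` of the disc, given by
its parameters `a ∈ 𝔻` and `lam ∈ T` (which are determined by `φ`). -/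
structure DiscAut where
  /-- the unimodular factor -/
  lam : Circle
  /-- the zero -/
  a : 𝔻

namespace DiscAut

/-- The formula of the automorphism, used on the closed disc. -/
def toFun (φ : DiscAut) (z : ℂ) : ℂ :=
  (φ.lam : ℂ) * (z - φ.a) / (1 - conj (φ.a : ℂ) * z)

lemma norm_toFun_lt_one (φ : DiscAut) (z : 𝔻) : ‖φ.toFun z‖ < 1 := by
  have ha := φ.a.normSq_lt_one
  have hz := z.normSq_lt_one
  have hid : Complex.normSq (1 - conj (φ.a : ℂ) * z) - Complex.normSq ((z : ℂ) - φ.a) =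
      (1 - Complex.normSq (φ.a : ℂ)) * (1 - Complex.normSq (z : ℂ)) := by
    simp [Complex.normSq_apply]
    ring
  have hlt : Complex.normSq ((z : ℂ) - φ.a) < Complex.normSq (1 - conj (φ.a : ℂ) * z) := by
    nlinarith [mul_pos (sub_pos.2 ha) (sub_pos.2 hz)]
  rw [Complex.normSq_eq_norm_sq, Complex.normSq_eq_norm_sq] at hlt
  have hlt' := lt_of_pow_lt_pow_left₀ 2 (norm_nonneg _) hlt
  rw [toFun, norm_div, norm_mul, Circle.norm_coe, one_mul,
    div_lt_one ((norm_nonneg _).trans_lt hlt')]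
  exact hlt'

/-- The automorphism as a self-map of the disc. -/
def toMap (φ : DiscAut) (z : 𝔻) : 𝔻 :=
  Complex.UnitDisc.mk (φ.toFun z) (φ.norm_toFun_lt_one z)

/-- `φ` is hyperbolic: it is not the identity and has two distinct fixed points on the unit
circle. -/
def IsHyperbolic (φ : DiscAut) : Prop :=
  φ.toMap ≠ id ∧ ∃ w₁ w₂ : ℂ, ‖w₁‖ = 1 ∧ ‖w₂‖ = 1 ∧ w₁ ≠ w₂ ∧
    φ.toFun w₁ = w₁ ∧ φ.toFun w₂ = w₂

end DiscAut

/-! ### The operators, first as maps on arbitrary functions on the disc -/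

/-- Multiplication `M_F`. -/
def mulOp (F : 𝔻 → ℂ) (f : 𝔻 → ℂ) : 𝔻 → ℂ := fun z => F z * f z

/-- Composition `C_φ`. -/
def compOp (φ : DiscAut) (f : 𝔻 → ℂ) : 𝔻 → ℂ := fun z => f (φ.toMap z)

/-- `U_φ = M_w C_φ` with `w = (conj lam * φ')^(1/p)`, principal branch of the power. -/
def weightedCompOp (p : ℝ≥0∞) (φ : DiscAut) (f : 𝔻 → ℂ) : 𝔻 → ℂ :=
  mulOp (fun z => (conj (φ.lam : ℂ) * deriv φ.toFun z) ^ (1 / (p.toReal : ℂ))) (compOp φ f)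

/-! ### Isometries of codimension one and the Crownover property -/

/-- `S` is an isometry whose range has codimension one in `H^p`. -/
def IsCodimOneIsometry (S : Hardy p →L[ℂ] Hardy p) : Prop :=
  Isometry S ∧ Module.finrank ℂ (Hardy p ⧸ LinearMap.range (S : Hardy p →ₗ[ℂ] Hardy p)) = 1

/-- `S` is Crownover: a codimension one isometry with `⋂_{n ≥ 1} S^n H^p = (0)`. -/
def IsCrownover (S : Hardy p →L[ℂ] Hardy p) : Prop :=
  IsCodimOneIsometry S ∧ (⋂ n : ℕ, ⋂ _ : 1 ≤ n, Set.range (S ^ n : Hardy p →L[ℂ] Hardy p)) = {0}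

end HardyDisc

end

open HardyDisc

/-!
Harmonic measure on the circle is determined by its moments, so an automorphism `φ` carries the
harmonic measure of `b` to that of `φ b`. Comparing densities, `U_φ` preserves integral means over
the circle, and `M_ψ = U_ψ M_z U_ψ⁻¹` does as well; hence `M_ψ U_φ` is an isometry, whose range
consists of the functions vanishing at the zero of `ψ`.

A hyperbolic `φ` is conjugate to a dilation `w ↦ μ w`, `0 < μ < 1`, of the right half-plane, so its
orbits approach the circle geometrically fast. In that model `w ^ (2πi / log μ)` is bounded and
`φ`-invariant. Subtracting its value at the zero of `ψ` gives a nonzero bounded function vanishing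
on the whole backward orbit of that zero, which can therefore be divided by `M_ψ U_φ` indefinitely.
-/

noncomputable section

namespace HardyDisc

/-! ### Automorphisms of the closed disc -/

lemma mul_conj_one_sub_conj_mul {z : ℂ} (hz : ‖z‖ = 1) (a : ℂ) :
    z * conj (1 - conj a * z) = z - a := by
  have hzz : z * conj z = 1 := by
    rw [Complex.mul_conj, Complex.normSq_eq_norm_sq, hz]
    simp
  simp only [map_sub, map_one, map_mul, Complex.conj_conj]
  linear_combination -a * hzz

lemma norm_one_sub_conj_mul {z : ℂ} (hz : ‖z‖ = 1) (a : ℂ) : ‖1 - conj a * z‖ = ‖z - a‖ := by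
  rw [← mul_conj_one_sub_conj_mul hz, norm_mul, hz, one_mul, RCLike.norm_conj]

namespace DiscAut

variable (φ : DiscAut) {z w : ℂ}

lemma re_denom_pos (hz : ‖z‖ ≤ 1) : 0 < (1 - conj (φ.a : ℂ) * z).re := by
  have h : ‖conj (φ.a : ℂ) * z‖ < 1 := by
    rw [norm_mul, RCLike.norm_conj]
    calc ‖(φ.a : ℂ)‖ * ‖z‖ ≤ ‖(φ.a : ℂ)‖ * 1 := by gcongr
      _ < 1 := by simpa using φ.a.norm_lt_one
  have := (Complex.re_le_norm (conj (φ.a : ℂ) * z)).trans_lt h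
  rw [Complex.sub_re, Complex.one_re]
  linarith

lemma denom_ne_zero (hz : ‖z‖ ≤ 1) : 1 - conj (φ.a : ℂ) * z ≠ 0 :=
  fun h => (φ.re_denom_pos hz).ne' (by rw [h, Complex.zero_re])

lemma one_sub_sq_norm_a_pos : 0 < 1 - ‖(φ.a : ℂ)‖ ^ 2 :=
  sub_pos.2 φ.a.sq_norm_lt_one

lemma ofReal_one_sub_sq_norm_a :
    ((1 - ‖(φ.a : ℂ)‖ ^ 2 : ℝ) : ℂ) = 1 - conj (φ.a : ℂ) * φ.a := by
  rw [mul_comm, Complex.mul_conj, Complex.normSq_eq_norm_sq]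
  push_cast
  rfl

lemma one_sub_conj_a_mul_a_ne_zero : 1 - conj (φ.a : ℂ) * φ.a ≠ 0 := by
  rw [← ofReal_one_sub_sq_norm_a]
  exact Complex.ofReal_ne_zero.2 φ.one_sub_sq_norm_a_pos.ne'

lemma conj_lam_mul_lam : conj (φ.lam : ℂ) * φ.lam = 1 := by
  rw [mul_comm, Complex.mul_conj, Circle.normSq_coe, Complex.ofReal_one]

lemma norm_toFun_eq_one (hz : ‖z‖ = 1) : ‖φ.toFun z‖ = 1 := by
  rw [toFun, norm_div, norm_mul, Circle.norm_coe, one_mul, ← norm_one_sub_conj_mul hz]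
  exact div_self (norm_ne_zero_iff.2 (φ.denom_ne_zero hz.le))

lemma norm_toFun_le_one (hz : ‖z‖ ≤ 1) : ‖φ.toFun z‖ ≤ 1 := by
  rcases hz.lt_or_eq with h | h
  · exact (φ.norm_toFun_lt_one (.mk z h)).le
  · exact (φ.norm_toFun_eq_one h).le

lemma toFun_a : φ.toFun φ.a = 0 := by simp [toFun]

@[simp] lemma coe_toMap (z : 𝔻) : (φ.toMap z : ℂ) = φ.toFun z := rfl

lemma toFun_sub_toFun (hz : ‖z‖ ≤ 1) (hw : ‖w‖ ≤ 1) :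
    φ.toFun z - φ.toFun w = φ.lam * (1 - conj (φ.a : ℂ) * φ.a) * (z - w) /
      ((1 - conj (φ.a : ℂ) * z) * (1 - conj (φ.a : ℂ) * w)) := by
  rw [toFun, toFun, div_sub_div _ _ (φ.denom_ne_zero hz) (φ.denom_ne_zero hw)]
  ring

lemma hasDerivAt_toFun (hz : ‖z‖ ≤ 1) :
    HasDerivAt φ.toFun
      (φ.lam * (1 - conj (φ.a : ℂ) * φ.a) / (1 - conj (φ.a : ℂ) * z) ^ 2) z := by
  have hnum : HasDerivAt (fun w : ℂ => (φ.lam : ℂ) * (w - φ.a)) ((φ.lam : ℂ) * 1) z :=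
    ((hasDerivAt_id z).sub_const _).const_mul _
  have hden : HasDerivAt (fun w : ℂ => 1 - conj (φ.a : ℂ) * w) (-(conj (φ.a : ℂ) * 1)) z :=
    ((hasDerivAt_id z).const_mul _).const_sub _
  refine (hnum.div hden (φ.denom_ne_zero hz)).congr_deriv ?_
  ring

lemma differentiableOn_toFun : DifferentiableOn ℂ φ.toFun (Metric.closedBall 0 1) := fun _ hz =>
  (φ.hasDerivAt_toFun (mem_closedBall_zero_iff.1 hz)).differentiableAt.differentiableWithinAt

lemma conj_lam_mul_deriv (hz : ‖z‖ ≤ 1) :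
    conj (φ.lam : ℂ) * deriv φ.toFun z =
      (1 - ‖(φ.a : ℂ)‖ ^ 2 : ℝ) * ((1 - conj (φ.a : ℂ) * z)⁻¹) ^ 2 := by
  rw [(φ.hasDerivAt_toFun hz).deriv, ofReal_one_sub_sq_norm_a, inv_pow, ← div_eq_mul_inv,
    ← mul_div_assoc, ← mul_assoc, conj_lam_mul_lam, one_mul]

/-- The inverse of `φ` in the group of automorphisms, again given by its parameters. -/
def inverse : DiscAut where
  lam := φ.lam⁻¹
  a := -(φ.lam • φ.a)

lemma inverse_lam : (φ.inverse.lam : ℂ) = conj (φ.lam : ℂ) := by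
  simp [inverse, ← Circle.coe_inv_eq_conj]

lemma inverse_a : (φ.inverse.a : ℂ) = -((φ.lam : ℂ) * φ.a) := by
  simp [inverse]

lemma norm_inverse_a : ‖(φ.inverse.a : ℂ)‖ = ‖(φ.a : ℂ)‖ := by
  rw [inverse_a, norm_neg, norm_mul, Circle.norm_coe, one_mul]

lemma inverse_inverse : φ.inverse.inverse = φ := by
  have ha : φ.inverse.inverse.a = φ.a := by
    apply Complex.UnitDisc.coe_injective
    rw [inverse_a, inverse_a, inverse_lam]
    linear_combination (φ.a : ℂ) * φ.conj_lam_mul_lam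
  have hlam : φ.inverse.inverse.lam = φ.lam := inv_inv φ.lam
  exact congrArg₂ DiscAut.mk hlam ha

lemma one_sub_conj_inverse_a_mul_toFun (hz : ‖z‖ ≤ 1) :
    1 - conj (φ.inverse.a : ℂ) * φ.toFun z =
      (1 - conj (φ.a : ℂ) * φ.a) / (1 - conj (φ.a : ℂ) * z) := by
  have hd := φ.denom_ne_zero hz
  rw [inverse_a, toFun]
  simp only [map_neg, map_mul]
  field_simp
  linear_combination (conj (φ.a : ℂ) * (z - φ.a)) * φ.conj_lam_mul_lam

lemma inverse_toFun (hz : ‖z‖ ≤ 1) : φ.inverse.toFun (φ.toFun z) = z := by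
  have hd := φ.denom_ne_zero hz
  have hd' : 1 - z * conj (φ.a : ℂ) ≠ 0 := by rwa [mul_comm]
  have ha := φ.one_sub_conj_a_mul_a_ne_zero
  have hnum : (φ.inverse.lam : ℂ) * (φ.toFun z - φ.inverse.a) =
      z * ((1 - conj (φ.a : ℂ) * φ.a) / (1 - conj (φ.a : ℂ) * z)) := by
    rw [inverse_lam, inverse_a, toFun]
    field_simp
    linear_combination (z - conj (φ.a : ℂ) * φ.a * z) * φ.conj_lam_mul_lam
  rw [toFun, hnum, φ.one_sub_conj_inverse_a_mul_toFun hz, mul_div_cancel_right₀ _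
    (div_ne_zero ha hd)]

lemma inverse_toMap (z : 𝔻) : φ.inverse.toMap (φ.toMap z) = z :=
  Complex.UnitDisc.coe_injective (φ.inverse_toFun z.norm_lt_one.le)

lemma toMap_inverse (z : 𝔻) : φ.toMap (φ.inverse.toMap z) = z := by
  have h := φ.inverse.inverse_toMap z
  rwa [inverse_inverse] at h

lemma toMap_injective : Function.Injective φ.toMap :=
  Function.LeftInverse.injective φ.inverse_toMap

/-- The weight `(conj lam * φ')^(1/p)` of `U_φ`, as a function on the closed disc. -/
def weight (p : ℝ≥0∞) (z : ℂ) : ℂ :=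
  (conj (φ.lam : ℂ) * deriv φ.toFun z) ^ (1 / (p.toReal : ℂ))

lemma conj_lam_mul_deriv_mem_slitPlane (hz : ‖z‖ ≤ 1) :
    conj (φ.lam : ℂ) * deriv φ.toFun z ∈ Complex.slitPlane := by
  set u : ℂ := (1 - conj (φ.a : ℂ) * z)⁻¹
  have hu : 0 < u.re := by
    rw [Complex.inv_re]
    exact div_pos (φ.re_denom_pos hz) (Complex.normSq_pos.2 (φ.denom_ne_zero hz))
  have hpos := φ.one_sub_sq_norm_a_pos
  rw [φ.conj_lam_mul_deriv hz, Complex.mem_slitPlane_iff, Complex.re_ofReal_mul,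
    Complex.im_ofReal_mul, pow_two (_⁻¹), Complex.mul_re, Complex.mul_im]
  rcases eq_or_ne u.im 0 with h | h
  · left
    rw [h, mul_zero, sub_zero]
    exact mul_pos hpos (mul_pos hu hu)
  · right
    have : u.re * u.im + u.im * u.re = 2 * (u.re * u.im) := by ring
    rw [this]
    exact mul_ne_zero hpos.ne' (mul_ne_zero two_ne_zero (mul_ne_zero hu.ne' h))

lemma weight_ne_zero (p : ℝ≥0∞) (hz : ‖z‖ ≤ 1) : φ.weight p z ≠ 0 := fun h =>
  Complex.slitPlane_ne_zero (φ.conj_lam_mul_deriv_mem_slitPlane hz)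
    ((Complex.cpow_eq_zero_iff _ _).1 h).1

lemma differentiableOn_weight (p : ℝ≥0∞) :
    DifferentiableOn ℂ (φ.weight p) (Metric.closedBall 0 1) := by
  have hderiv : DifferentiableOn ℂ (fun z => conj (φ.lam : ℂ) * deriv φ.toFun z)
      (Metric.closedBall 0 1) := by
    refine DifferentiableOn.congr ?_ fun z hz => φ.conj_lam_mul_deriv (mem_closedBall_zero_iff.1 hz)
    exact (DifferentiableOn.pow (DifferentiableOn.inv (by fun_prop)
      fun z hz => φ.denom_ne_zero (mem_closedBall_zero_iff.1 hz)) 2).const_mul _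
  exact hderiv.cpow_const fun z hz =>
    φ.conj_lam_mul_deriv_mem_slitPlane (mem_closedBall_zero_iff.1 hz)

lemma weight_mul_weight_inverse (p : ℝ≥0∞) (hz : ‖z‖ ≤ 1) :
    φ.weight p z * φ.inverse.weight p (φ.toFun z) = 1 := by
  have ha := φ.one_sub_conj_a_mul_a_ne_zero
  have hd := φ.denom_ne_zero hz
  have h : conj (φ.inverse.lam : ℂ) * deriv φ.inverse.toFun (φ.toFun z) =
      (conj (φ.lam : ℂ) * deriv φ.toFun z)⁻¹ := by
    rw [φ.inverse.conj_lam_mul_deriv (φ.norm_toFun_le_one hz), φ.conj_lam_mul_deriv hz,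
      φ.one_sub_conj_inverse_a_mul_toFun hz, norm_inverse_a, ofReal_one_sub_sq_norm_a]
    field_simp
  have harg := Complex.slitPlane_arg_ne_pi (φ.conj_lam_mul_deriv_mem_slitPlane hz)
  rw [weight, weight, h, Complex.inv_cpow _ _ harg]
  exact mul_inv_cancel₀ (φ.weight_ne_zero p hz)

lemma norm_weight_rpow {p : ℝ≥0∞} (hp : p.toReal ≠ 0) (hz : ‖z‖ = 1) :
    ‖φ.weight p z‖ ^ p.toReal = poissonKernel 0 φ.a z := by
  have hexp : (1 / (p.toReal : ℂ)) = ((1 / p.toReal : ℝ) : ℂ) := by push_cast; rfl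
  rw [weight, hexp, Complex.norm_cpow_real, ← Real.rpow_mul (norm_nonneg _), one_div_mul_cancel hp,
    Real.rpow_one, φ.conj_lam_mul_deriv hz.le, norm_mul, norm_pow, norm_inv,
    norm_one_sub_conj_mul hz, Complex.norm_real, Real.norm_of_nonneg φ.one_sub_sq_norm_a_pos.le,
    poissonKernel_def, sub_zero, sub_zero, hz, inv_pow, one_pow, div_eq_mul_inv]

end DiscAut

/-! ### Harmonic measure -/

instance : MeasurableSpace Circle := borel Circle

instance : BorelSpace Circle := ⟨rfl⟩

/-- The coordinate `ζ ↦ ζ` of the unit circle, as a bounded continuous function. -/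
def circleCoord : BoundedContinuousFunction Circle ℂ :=
  BoundedContinuousFunction.mkOfCompact ⟨fun ζ => (ζ : ℂ), by fun_prop⟩

@[simp] lemma circleCoord_apply (ζ : Circle) : circleCoord ζ = ζ := rfl

lemma exists_zpow_of_mem_closure_circleCoord {f : BoundedContinuousFunction Circle ℂ}
    (hf : f ∈ Submonoid.closure ({circleCoord} ∪ star {circleCoord})) :
    ∃ k : ℤ, ∀ ζ, f ζ = ((ζ ^ k : Circle) : ℂ) := by
  induction hf using Submonoid.closure_induction with
  | mem f hf =>
    rcases hf with rfl | hf
    · exact ⟨1, fun ζ => by simp⟩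
    · refine ⟨-1, fun ζ => ?_⟩
      rw [← star_star f, Set.mem_singleton_iff.1 hf, zpow_neg_one, Circle.coe_inv_eq_conj]
      rfl
  | one => exact ⟨0, fun ζ => by simp⟩
  | mul f₁ f₂ _ _ h₁ h₂ =>
    obtain ⟨k, hk⟩ := h₁
    obtain ⟨l, hl⟩ := h₂
    exact ⟨k + l, fun ζ => by simp [hk, hl, zpow_add]⟩

theorem ext_of_forall_integral_coe_pow_eq {μ ν : Measure Circle} [IsFiniteMeasure μ]
    [IsFiniteMeasure ν] (h : ∀ n : ℕ, ∫ ζ, (ζ : ℂ) ^ n ∂μ = ∫ ζ, (ζ : ℂ) ^ n ∂ν) : μ = ν := by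
  have hzpow (k : ℤ) : ∫ ζ, ((ζ ^ k : Circle) : ℂ) ∂μ = ∫ ζ, ((ζ ^ k : Circle) : ℂ) ∂ν := by
    obtain ⟨n, rfl | rfl⟩ := k.eq_nat_or_neg
    · simpa using h n
    · simp only [zpow_neg, zpow_natCast, Circle.coe_inv_eq_conj, Circle.coe_pow, integral_conj, h n]
  refine ext_of_forall_mem_subalgebra_integral_eq_of_polish
    (A := StarAlgebra.adjoin ℂ {circleCoord}) ?_ fun g hg => ?_
  · exact fun ζ η hne => ⟨_, ⟨_, ⟨circleCoord, StarAlgebra.self_mem_adjoin_singleton ℂ _, rfl⟩,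
      rfl⟩, fun heq => hne (Circle.ext heq)⟩
  · rw [← StarSubalgebra.mem_toSubalgebra, StarAlgebra.adjoin_toSubalgebra,
      ← Subalgebra.mem_toSubmodule, Algebra.adjoin_eq_span] at hg
    induction hg using Submodule.span_induction with
    | mem f hf =>
      obtain ⟨k, hk⟩ := exists_zpow_of_mem_closure_circleCoord hf
      simpa only [hk] using hzpow k
    | zero => simp
    | add f₁ f₂ _ _ h₁ h₂ =>
      simp only [BoundedContinuousFunction.coe_add, Pi.add_apply]
      rw [integral_add (f₁.integrable μ) (f₂.integrable μ),
        integral_add (f₁.integrable ν) (f₂.integrable ν), h₁, h₂]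
    | smul c f _ h =>
      simp only [BoundedContinuousFunction.coe_smul, integral_smul, h]

instance : IsProbabilityMeasure circleMeasure := ⟨by
  rw [circleMeasure, Measure.smul_apply, Measure.restrict_apply_univ, Real.volume_Ioc, sub_zero,
    smul_eq_mul, ← ENNReal.ofReal_mul (by positivity), inv_mul_cancel₀ (by positivity),
    ENNReal.ofReal_one]⟩

/-- Normalized arc length, carried by the unit circle itself rather than by the angle. -/
def arcMeasure : Measure Circle := circleMeasure.map Circle.exp

instance : IsProbabilityMeasure arcMeasure :=
  Measure.isProbabilityMeasure_map (by fun_prop)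

lemma integral_arcMeasure {E : Type*} [NormedAddCommGroup E] [NormedSpace ℝ E] {g : ℂ → E}
    (hg : Continuous fun ζ : Circle => g ζ) :
    ∫ ζ : Circle, g ζ ∂arcMeasure = Real.circleAverage g 0 1 := by
  rw [arcMeasure, integral_map (by fun_prop) hg.aestronglyMeasurable, circleMeasure,
    integral_smul_measure, ENNReal.toReal_ofReal (by positivity), Real.circleAverage_def,
    intervalIntegral.integral_of_le Real.two_pi_pos.le]
  simp [circleMap]

lemma poissonKernel_nonneg (b : 𝔻) (ζ : Circle) : 0 ≤ poissonKernel 0 (b : ℂ) ζ := by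
  rw [poissonKernel_def]
  have := b.sq_norm_lt_one
  simp only [sub_zero, Circle.norm_coe]
  exact div_nonneg (by linarith) (sq_nonneg _)

lemma continuous_poissonKernel :
    Continuous fun x : 𝔻 × Circle => poissonKernel 0 (x.1 : ℂ) x.2 := by
  simp only [poissonKernel_def, sub_zero, Circle.norm_coe]
  refine Continuous.div (by fun_prop) (by fun_prop) fun x => ?_
  have : (x.2 : ℂ) ≠ x.1 := fun h => x.1.norm_lt_one.ne (by rw [← h, Circle.norm_coe])
  simpa [sub_eq_zero] using this

lemma continuous_poissonKernel_right (b : 𝔻) :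
    Continuous fun ζ : Circle => poissonKernel 0 (b : ℂ) ζ := by
  have h := continuous_poissonKernel.comp (Continuous.prodMk_right b)
  exact h

/-- Harmonic measure of the unit circle seen from the point `b` of the disc. -/
def harmonicMeasure (b : 𝔻) : Measure Circle :=
  arcMeasure.withDensity fun ζ => ENNReal.ofReal (poissonKernel 0 (b : ℂ) ζ)

lemma lintegral_harmonicMeasure (b : 𝔻) {u : Circle → ℝ≥0∞} (hu : Measurable u) :
    ∫⁻ ζ, u ζ ∂harmonicMeasure b =
      ∫⁻ ζ, ENNReal.ofReal (poissonKernel 0 (b : ℂ) ζ) * u ζ ∂arcMeasure :=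
  lintegral_withDensity_eq_lintegral_mul _
    (continuous_poissonKernel_right b).measurable.ennreal_ofReal hu

lemma continuous_comp_coe_circle {E : Type*} [NormedAddCommGroup E] [NormedSpace ℂ E]
    {g : ℂ → E} (hg : DiffContOnCl ℂ g (Metric.ball 0 1)) :
    Continuous fun ζ : Circle => g ζ :=
  hg.continuousOn_ball.comp_continuous (by fun_prop)
    fun ζ => mem_closedBall_zero_iff.2 ζ.norm_coe.le

theorem integral_harmonicMeasure {E : Type*} [NormedAddCommGroup E] [NormedSpace ℂ E]
    [CompleteSpace E] {g : ℂ → E} (hg : DiffContOnCl ℂ g (Metric.ball 0 1)) (b : 𝔻) :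
    ∫ ζ : Circle, g ζ ∂harmonicMeasure b = g b := by
  have hc := continuous_comp_coe_circle hg
  rw [harmonicMeasure, integral_withDensity_eq_integral_toReal_smul
    (continuous_poissonKernel_right b).measurable.ennreal_ofReal (by simp)]
  simp only [ENNReal.toReal_ofReal (poissonKernel_nonneg b _)]
  exact (integral_arcMeasure ((continuous_poissonKernel_right b).smul hc)).trans
    (hg.circleAverage_poissonKernel_smul (by simpa using b.norm_lt_one))

instance (b : 𝔻) : IsProbabilityMeasure (harmonicMeasure b) := ⟨by
  have h := integral_harmonicMeasure (diffContOnCl_const (c := (1 : ℂ))) b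
  rw [integral_const, Complex.real_smul, mul_one, Complex.ofReal_eq_one] at h
  exact (ENNReal.toReal_eq_one_iff _).1 h⟩

lemma harmonicMeasure_zero : harmonicMeasure 0 = arcMeasure := by
  simp [harmonicMeasure, poissonKernel_def]

lemma poissonKernel_smul_comm (z : 𝔻) (ζ η : Circle) :
    poissonKernel 0 ((ζ • z : 𝔻) : ℂ) η = poissonKernel 0 ((η • star z : 𝔻) : ℂ) ζ := by
  have h : ‖(η : ℂ) - ζ * z‖ = ‖(ζ : ℂ) - η * conj (z : ℂ)‖ := by
    rw [← norm_one_sub_conj_mul η.norm_coe, ← norm_one_sub_conj_mul ζ.norm_coe, ← RCLike.norm_conj]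
    congr 1
    simp only [map_sub, map_one, map_mul, Complex.conj_conj]
    ring
  simp [poissonKernel_def, h, Circle.norm_coe]

namespace DiscAut

variable (φ : DiscAut)

/-- The automorphism as a self-map of the unit circle. -/
def onCircle (ζ : Circle) : Circle :=
  ⟨φ.toFun ζ, mem_sphere_zero_iff_norm.2 (φ.norm_toFun_eq_one ζ.norm_coe)⟩

lemma continuous_onCircle : Continuous φ.onCircle :=
  (φ.differentiableOn_toFun.continuousOn.comp_continuous (by fun_prop)
    fun ζ => mem_closedBall_zero_iff.2 ζ.norm_coe.le).subtype_mk _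

theorem map_onCircle_harmonicMeasure (b : 𝔻) :
    (harmonicMeasure b).map φ.onCircle = harmonicMeasure (φ.toMap b) := by
  have hφ := φ.continuous_onCircle
  have := Measure.isProbabilityMeasure_map (μ := harmonicMeasure b) hφ.aemeasurable
  refine ext_of_forall_integral_coe_pow_eq fun n => ?_
  calc ∫ ζ : Circle, (ζ : ℂ) ^ n ∂(harmonicMeasure b).map φ.onCircle
      = ∫ ζ : Circle, φ.toFun ζ ^ n ∂harmonicMeasure b :=
        integral_map hφ.aemeasurable (by fun_prop)
    _ = φ.toFun b ^ n := integral_harmonicMeasure (g := fun z => φ.toFun z ^ n)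
        ((φ.differentiableOn_toFun.pow n).diffContOnCl_ball subset_rfl) b
    _ = ∫ ζ : Circle, (ζ : ℂ) ^ n ∂harmonicMeasure (φ.toMap b) :=
        (integral_harmonicMeasure (g := fun z => z ^ n)
          (differentiable_id.pow n).diffContOnCl (φ.toMap b)).symm

theorem eLpNorm_weight_mul_comp_onCircle {p : ℝ≥0∞} (hp0 : p ≠ 0) (hp_top : p ≠ ∞)
    {g : Circle → ℂ} (hg : Measurable g) :
    eLpNorm (fun ζ : Circle => φ.weight p ζ * g (φ.onCircle ζ)) p arcMeasure =
      eLpNorm g p arcMeasure := by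
  have hu : Measurable fun ζ => ‖g ζ‖ₑ ^ p.toReal := by fun_prop
  have hφ := φ.continuous_onCircle.measurable
  have hp := (ENNReal.toReal_pos hp0 hp_top).ne'
  rw [eLpNorm_eq_lintegral_rpow_enorm_toReal hp0 hp_top,
    eLpNorm_eq_lintegral_rpow_enorm_toReal hp0 hp_top]
  congr 1
  calc ∫⁻ ζ : Circle, ‖φ.weight p ζ * g (φ.onCircle ζ)‖ₑ ^ p.toReal ∂arcMeasure
      = ∫⁻ ζ, ENNReal.ofReal (poissonKernel 0 (φ.a : ℂ) ζ) *
          ‖g (φ.onCircle ζ)‖ₑ ^ p.toReal ∂arcMeasure := by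
        refine lintegral_congr fun ζ => ?_
        rw [enorm_mul, ENNReal.mul_rpow_of_nonneg _ _ ENNReal.toReal_nonneg,
          ← φ.norm_weight_rpow hp ζ.norm_coe, ← ofReal_norm,
          ENNReal.ofReal_rpow_of_nonneg (norm_nonneg _) ENNReal.toReal_nonneg]
    _ = ∫⁻ ζ, ‖g (φ.onCircle ζ)‖ₑ ^ p.toReal ∂harmonicMeasure φ.a :=
        (lintegral_harmonicMeasure φ.a (hu.comp hφ)).symm
    _ = ∫⁻ ζ, ‖g ζ‖ₑ ^ p.toReal ∂(harmonicMeasure φ.a).map φ.onCircle :=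
        (lintegral_map hu hφ).symm
    _ = ∫⁻ ζ, ‖g ζ‖ₑ ^ p.toReal ∂arcMeasure := by
        have h0 : φ.toMap φ.a = 0 := Complex.UnitDisc.coe_injective φ.toFun_a
        rw [map_onCircle_harmonicMeasure, h0, harmonicMeasure_zero]

end DiscAut

/-! ### Integral means of analytic functions -/

section DiffContOnCl

variable {E : Type*} [NormedAddCommGroup E] [NormedSpace ℂ E] [CompleteSpace E]
  {g : ℂ → E} {p : ℝ≥0∞}

theorem enorm_le_eLpNorm_harmonicMeasure (hg : DiffContOnCl ℂ g (Metric.ball 0 1)) (hp : 1 ≤ p)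
    (b : 𝔻) : ‖g b‖ₑ ≤ eLpNorm (fun ζ : Circle => g ζ) p (harmonicMeasure b) :=
  calc ‖g b‖ₑ = ‖∫ ζ : Circle, g ζ ∂harmonicMeasure b‖ₑ := by rw [integral_harmonicMeasure hg]
    _ ≤ ∫⁻ ζ : Circle, ‖g ζ‖ₑ ∂harmonicMeasure b := enorm_integral_le_lintegral_enorm _
    _ = eLpNorm (fun ζ : Circle => g ζ) 1 (harmonicMeasure b) := eLpNorm_one_eq_lintegral_enorm.symm
    _ ≤ eLpNorm (fun ζ : Circle => g ζ) p (harmonicMeasure b) :=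
      eLpNorm_le_eLpNorm_of_exponent_le hp (continuous_comp_coe_circle hg).aestronglyMeasurable

lemma lintegral_lintegral_harmonicMeasure_smul (z : 𝔻) {u : Circle → ℝ≥0∞} (hu : Measurable u) :
    ∫⁻ ζ : Circle, ∫⁻ η, u η ∂harmonicMeasure (ζ • z) ∂arcMeasure = ∫⁻ η, u η ∂arcMeasure := by
  have hsmul : Continuous fun x : Circle × Circle => ((x.1 • z, x.2) : 𝔻 × Circle) :=
    (Complex.UnitDisc.isEmbedding_coe.continuous_iff.2 (by
      simpa [Function.comp_def] using by fun_prop)).prodMk continuous_snd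
  have hker := continuous_poissonKernel.comp hsmul
  have hmeas : Measurable fun x : Circle × Circle =>
      ENNReal.ofReal (poissonKernel 0 ((x.1 • z : 𝔻) : ℂ) x.2) * u x.2 :=
    hker.measurable.ennreal_ofReal.mul (hu.comp measurable_snd)
  calc ∫⁻ ζ : Circle, ∫⁻ η, u η ∂harmonicMeasure (ζ • z) ∂arcMeasure
      = ∫⁻ ζ : Circle, ∫⁻ η : Circle,
          ENNReal.ofReal (poissonKernel 0 ((ζ • z : 𝔻) : ℂ) η) * u η ∂arcMeasure ∂arcMeasure :=
        lintegral_congr fun ζ => lintegral_harmonicMeasure _ hu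
    _ = ∫⁻ η : Circle, ∫⁻ ζ : Circle,
          ENNReal.ofReal (poissonKernel 0 ((η • star z : 𝔻) : ℂ) ζ) * u η ∂arcMeasure
            ∂arcMeasure := by
        simp_rw [← poissonKernel_smul_comm]
        exact lintegral_lintegral_swap hmeas.aemeasurable
    _ = ∫⁻ η : Circle, ∫⁻ _, u η ∂harmonicMeasure (η • star z) ∂arcMeasure :=
        lintegral_congr fun η => (lintegral_harmonicMeasure _ measurable_const).symm
    _ = ∫⁻ η, u η ∂arcMeasure := by simp

theorem eLpNorm_smul_le (hg : DiffContOnCl ℂ g (Metric.ball 0 1)) (hp : 1 ≤ p) (hp_top : p ≠ ∞)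
    (z : 𝔻) :
    eLpNorm (fun ζ : Circle => g (ζ • z : 𝔻)) p arcMeasure ≤
      eLpNorm (fun ζ : Circle => g ζ) p arcMeasure := by
  have hp0 : p ≠ 0 := (zero_lt_one.trans_le hp).ne'
  have hpr := ENNReal.toReal_pos hp0 hp_top
  have hu : Measurable fun ζ : Circle => ‖g ζ‖ₑ ^ p.toReal :=
    (continuous_comp_coe_circle hg).enorm.measurable.pow_const _
  rw [eLpNorm_eq_lintegral_rpow_enorm_toReal hp0 hp_top,
    eLpNorm_eq_lintegral_rpow_enorm_toReal hp0 hp_top,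
    ← lintegral_lintegral_harmonicMeasure_smul z hu]
  gcongr with ζ
  rw [← ENNReal.le_rpow_inv_iff hpr, ← one_div, ← eLpNorm_eq_lintegral_rpow_enorm_toReal hp0 hp_top]
  exact enorm_le_eLpNorm_harmonicMeasure hg hp _

end DiffContOnCl

lemma diffContOnCl_dilation {F : ℂ → ℂ} (hF : DifferentiableOn ℂ F (Metric.ball 0 1))
    (s : Set.Ioo (0 : ℝ) 1) : DiffContOnCl ℂ (fun z => F (s * z)) (Metric.ball 0 1) := by
  refine DifferentiableOn.diffContOnCl (hF.comp (by fun_prop) fun z hz => ?_)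
  rw [closure_ball _ one_ne_zero, mem_closedBall_zero_iff] at hz
  rw [mem_ball_zero_iff, norm_mul, Complex.norm_of_nonneg s.2.1.le]
  exact (mul_le_of_le_one_right s.2.1.le hz).trans_lt s.2.2

lemma circleNorm_le_hardyENorm (p : ℝ≥0∞) (f : 𝔻 → ℂ) (r : Set.Ioo (0 : ℝ) 1) :
    circleNorm p f r ≤ hardyENorm p f := le_iSup (circleNorm p f) r

lemma circleNorm_eq_eLpNorm_arcMeasure (p : ℝ≥0∞) {F : ℂ → ℂ}
    (hF : ContinuousOn F (Metric.ball 0 1)) (r : Set.Ioo (0 : ℝ) 1) :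
    circleNorm p (fun z => F z) r = eLpNorm (fun ζ : Circle => F (r * ζ)) p arcMeasure := by
  have hc : Continuous fun ζ : Circle => F (r * ζ) :=
    hF.comp_continuous (by fun_prop) fun ζ => by
      simpa [Circle.norm_coe, abs_of_pos r.2.1] using r.2.2
  rw [arcMeasure, eLpNorm_map_measure hc.aestronglyMeasurable (by fun_prop)]
  simp [circleNorm, circlePt, circleMap, Function.comp_def]

section IntegralMeans

variable {p : ℝ≥0∞} {f : 𝔻 → ℂ}

theorem hardyENorm_le_eLpNorm_arcMeasure (hp : 1 ≤ p) (hp_top : p ≠ ∞) {g : ℂ → ℂ}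
    (hg : DiffContOnCl ℂ g (Metric.ball 0 1)) :
    hardyENorm p (fun z => g z) ≤ eLpNorm (fun ζ : Circle => g ζ) p arcMeasure := by
  refine iSup_le fun r => ?_
  rw [circleNorm_eq_eLpNorm_arcMeasure p hg.differentiableOn.continuousOn]
  simpa [circlePt, circleMap, mul_comm] using eLpNorm_smul_le hg hp hp_top (circlePt r 0)

theorem monotone_circleNorm (hp : 1 ≤ p) (hp_top : p ≠ ∞) (hf : IsAnalytic f) :
    Monotone (circleNorm p f) := by
  intro r s hrs
  rcases eq_or_lt_of_le hrs with rfl | hlt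
  · rfl
  obtain ⟨F, hF, hfF⟩ := hf
  obtain rfl : f = fun z : 𝔻 => F z := funext hfF
  have hdiv : (r : ℝ) / s ∈ Set.Ioo (0 : ℝ) 1 := ⟨div_pos r.2.1 s.2.1, (div_lt_one s.2.1).2 hlt⟩
  have hs : (s : ℂ) ≠ 0 := Complex.ofReal_ne_zero.2 s.2.1.ne'
  have hg := diffContOnCl_dilation hF s
  have hrescale : circleNorm p (fun z => F z) r =
      circleNorm p (fun z : 𝔻 => (fun w => F (s * w)) (z : ℂ)) ⟨r / s, hdiv⟩ := by
    rw [circleNorm_eq_eLpNorm_arcMeasure p hF.continuousOn,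
      circleNorm_eq_eLpNorm_arcMeasure p hg.differentiableOn.continuousOn]
    simp only [Complex.ofReal_div, ← mul_assoc, mul_div_cancel₀ _ hs]
  have hle := hardyENorm_le_eLpNorm_arcMeasure hp hp_top hg
  have hs_eq := circleNorm_eq_eLpNorm_arcMeasure p hF.continuousOn s
  rw [hrescale, hs_eq]
  exact (circleNorm_le_hardyENorm p _ _).trans hle

lemma circleNorm_coe_mul (p : ℝ≥0∞) (f : 𝔻 → ℂ) (r : Set.Ioo (0 : ℝ) 1) :
    circleNorm p (fun z => (z : ℂ) * f z) r = ENNReal.ofReal r * circleNorm p f r := by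
  have h : ENNReal.ofReal r = ‖(r : ℝ)‖ₑ := (Real.enorm_of_nonneg r.2.1.le).symm
  rw [circleNorm, circleNorm, h, ← eLpNorm_const_smul]
  refine eLpNorm_congr_norm_ae (.of_forall fun θ => ?_)
  simp [circlePt]

theorem hardyENorm_coe_mul (hp : 1 ≤ p) (hp_top : p ≠ ∞) (hf : IsAnalytic f) :
    hardyENorm p (fun z => (z : ℂ) * f z) = hardyENorm p f := by
  refine le_antisymm (iSup_le fun r => ?_) (iSup_le fun r => ?_)
  · rw [circleNorm_coe_mul]
    exact (mul_le_of_le_one_left' (ENNReal.ofReal_le_one.2 r.2.2.le)).trans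
      (circleNorm_le_hardyENorm p f r)
  · have hlt (t : ℝ) (ht : t ∈ Set.Ioo (r : ℝ) 1) :
        ENNReal.ofReal t * circleNorm p f r ≤ hardyENorm p fun z => (z : ℂ) * f z := by
      have ht' : t ∈ Set.Ioo (0 : ℝ) 1 := ⟨r.2.1.trans ht.1, ht.2⟩
      calc ENNReal.ofReal t * circleNorm p f r ≤ ENNReal.ofReal t * circleNorm p f ⟨t, ht'⟩ :=
            mul_right_mono (monotone_circleNorm hp hp_top hf ht.1.le)
        _ = circleNorm p (fun z => (z : ℂ) * f z) ⟨t, ht'⟩ := (circleNorm_coe_mul p f ⟨t, ht'⟩).symm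
        _ ≤ hardyENorm p fun z => (z : ℂ) * f z := circleNorm_le_hardyENorm p _ _
    have hlim : Filter.Tendsto (fun t => ENNReal.ofReal t * circleNorm p f r)
        (nhdsWithin 1 (Set.Iio 1)) (nhds (ENNReal.ofReal 1 * circleNorm p f r)) :=
      ENNReal.Tendsto.mul_const
        (ENNReal.tendsto_ofReal (tendsto_nhdsWithin_of_tendsto_nhds Filter.tendsto_id)) (by simp)
    rw [ENNReal.ofReal_one, one_mul] at hlim
    exact le_of_tendsto hlim (Filter.eventually_of_mem (Ioo_mem_nhdsLT r.2.2) hlt)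

theorem hardyENorm_le_of_tendsto {u : ℕ → 𝔻 → ℂ} (hu : ∀ n, Continuous (u n))
    (hlim : ∀ z, Filter.Tendsto (fun n => u n z) Filter.atTop (nhds (f z))) {C : ℝ≥0∞}
    (hC : ∀ n, hardyENorm p (u n) ≤ C) : hardyENorm p f ≤ C := by
  refine iSup_le fun r => ?_
  calc circleNorm p f r ≤ Filter.atTop.liminf fun n => circleNorm p (u n) r :=
        Lp.eLpNorm_lim_le_liminf_eLpNorm
          (fun n => ((hu n).comp (continuous_circlePt r)).aestronglyMeasurable) _
          (.of_forall fun θ => hlim _)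
    _ ≤ C := Filter.liminf_le_of_le (by isBoundedDefault) fun b hb => by
        obtain ⟨n, hn⟩ := hb.exists
        exact hn.trans ((circleNorm_le_hardyENorm p (u n) r).trans (hC n))

end IntegralMeans

/-! ### The operators `U_φ` and `M_ψ` -/

section Operators

variable {p : ℝ≥0∞} {f : 𝔻 → ℂ}

lemma weightedCompOp_apply (p : ℝ≥0∞) (φ : DiscAut) (f : 𝔻 → ℂ) (z : 𝔻) :
    weightedCompOp p φ f z = φ.weight p z * f (φ.toMap z) := rfl

lemma weightedCompOp_weightedCompOp_inverse (p : ℝ≥0∞) (φ : DiscAut) (f : 𝔻 → ℂ) :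
    weightedCompOp p φ (weightedCompOp p φ.inverse f) = f := by
  funext z
  rw [weightedCompOp_apply, weightedCompOp_apply, ← mul_assoc, DiscAut.coe_toMap,
    φ.weight_mul_weight_inverse p z.norm_lt_one.le, one_mul, φ.inverse_toMap]

lemma weightedCompOp_inverse_weightedCompOp (p : ℝ≥0∞) (φ : DiscAut) (f : 𝔻 → ℂ) :
    weightedCompOp p φ.inverse (weightedCompOp p φ f) = f := by
  simpa only [φ.inverse_inverse] using weightedCompOp_weightedCompOp_inverse p φ.inverse f

lemma IsAnalytic.weightedCompOp (hf : IsAnalytic f) (p : ℝ≥0∞) (φ : DiscAut) :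
    IsAnalytic (weightedCompOp p φ f) := by
  obtain ⟨F, hF, hfF⟩ := hf
  refine ⟨fun z => φ.weight p z * F (φ.toFun z), ?_, fun z => ?_⟩
  · refine ((φ.differentiableOn_weight p).mono Metric.ball_subset_closedBall).mul
      (hF.comp (φ.differentiableOn_toFun.mono Metric.ball_subset_closedBall) fun z hz => ?_)
    rw [mem_ball_zero_iff] at hz ⊢
    exact φ.norm_toFun_lt_one (.mk z hz)
  · rw [weightedCompOp_apply, hfF, DiscAut.coe_toMap]

lemma IsAnalytic.mulOp_toMap (hf : IsAnalytic f) (ψ : DiscAut) :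
    IsAnalytic (mulOp (fun z => (ψ.toMap z : ℂ)) f) := by
  obtain ⟨F, hF, hfF⟩ := hf
  refine ⟨fun z => ψ.toFun z * F z,
    (ψ.differentiableOn_toFun.mono Metric.ball_subset_closedBall).mul hF, fun z => ?_⟩
  rw [mulOp, hfF, DiscAut.coe_toMap]

lemma IsAnalytic.coe_mul (hf : IsAnalytic f) : IsAnalytic fun z => (z : ℂ) * f z := by
  obtain ⟨F, hF, hfF⟩ := hf
  exact ⟨fun z => z * F z, differentiableOn_id.mul hF, fun z => congrArg ((z : ℂ) * ·) (hfF z)⟩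

lemma hardyENorm_weightedCompOp_le_eLpNorm (hp : 1 ≤ p) (hp_top : p ≠ ∞) (φ : DiscAut) {g : ℂ → ℂ}
    (hg : DiffContOnCl ℂ g (Metric.ball 0 1)) :
    hardyENorm p (weightedCompOp p φ fun z => g z) ≤
      eLpNorm (fun ζ : Circle => g ζ) p arcMeasure := by
  have hmaps : Set.MapsTo φ.toFun (Metric.ball 0 1) (Metric.ball 0 1) := fun z hz => by
    rw [mem_ball_zero_iff] at hz ⊢
    exact φ.norm_toFun_lt_one (.mk z hz)
  have hcomp : DiffContOnCl ℂ (fun z => φ.weight p z * g (φ.toFun z)) (Metric.ball 0 1) :=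
    ((φ.differentiableOn_weight p).diffContOnCl_ball subset_rfl).smul
      (hg.comp (φ.differentiableOn_toFun.diffContOnCl_ball subset_rfl) hmaps)
  have hle := hardyENorm_le_eLpNorm_arcMeasure hp hp_top hcomp
  have heq := φ.eLpNorm_weight_mul_comp_onCircle (zero_lt_one.trans_le hp).ne' hp_top
    (continuous_comp_coe_circle hg).measurable
  exact hle.trans_eq heq

lemma hardyENorm_weightedCompOp_le (hp : 1 ≤ p) (hp_top : p ≠ ∞) (φ : DiscAut)
    (hf : IsAnalytic f) : hardyENorm p (weightedCompOp p φ f) ≤ hardyENorm p f := by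
  obtain ⟨F, hF, hfF⟩ := id hf
  obtain rfl : f = fun z : 𝔻 => F z := funext hfF
  obtain ⟨s, -, hs, hlim⟩ := exists_seq_strictMono_tendsto' (zero_lt_one (α := ℝ))
  have hg (n : ℕ) := diffContOnCl_dilation hF ⟨s n, hs n⟩
  have hg_an (n : ℕ) : IsAnalytic fun z : 𝔻 => F (s n * z) :=
    ⟨_, (hg n).differentiableOn, fun _ => rfl⟩
  refine hardyENorm_le_of_tendsto (u := fun n => weightedCompOp p φ fun z => F (s n * z))
    (fun n => ((hg_an n).weightedCompOp p φ).continuous) (fun z => ?_) fun n => ?_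
  · have hcont : ContinuousAt F (φ.toMap z) :=
      (hF.differentiableAt (Metric.isOpen_ball.mem_nhds
        (mem_ball_zero_iff.2 (φ.toMap z).norm_lt_one))).continuousAt
    have hscale : Filter.Tendsto (fun n => (s n : ℂ) * φ.toMap z) Filter.atTop
        (nhds (φ.toMap z : ℂ)) := by
      simpa using ((Complex.continuous_ofReal.tendsto 1).comp hlim).mul_const (φ.toMap z : ℂ)
    exact (hcont.tendsto.comp hscale).const_mul _
  · have hle := hardyENorm_weightedCompOp_le_eLpNorm hp hp_top φ (hg n)
    have heq := circleNorm_eq_eLpNorm_arcMeasure p hF.continuousOn ⟨s n, hs n⟩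
    exact (hle.trans_eq heq.symm).trans (circleNorm_le_hardyENorm p _ _)

theorem hardyENorm_weightedCompOp (hp : 1 ≤ p) (hp_top : p ≠ ∞) (φ : DiscAut)
    (hf : IsAnalytic f) : hardyENorm p (weightedCompOp p φ f) = hardyENorm p f := by
  refine le_antisymm (hardyENorm_weightedCompOp_le hp hp_top φ hf) ?_
  simpa only [weightedCompOp_inverse_weightedCompOp] using
    hardyENorm_weightedCompOp_le hp hp_top φ.inverse (hf.weightedCompOp p φ)

lemma mulOp_toMap_eq_weightedCompOp (p : ℝ≥0∞) (ψ : DiscAut) (f : 𝔻 → ℂ) :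
    mulOp (fun z => (ψ.toMap z : ℂ)) f =
      weightedCompOp p ψ fun z => (z : ℂ) * weightedCompOp p ψ.inverse f z := by
  funext z
  have h := congrFun (weightedCompOp_weightedCompOp_inverse p ψ f) z
  rw [weightedCompOp_apply] at h
  rw [weightedCompOp_apply, mulOp, mul_left_comm, h]

theorem hardyENorm_mulOp_toMap (hp : 1 ≤ p) (hp_top : p ≠ ∞) (ψ : DiscAut) (hf : IsAnalytic f) :
    hardyENorm p (mulOp (fun z => (ψ.toMap z : ℂ)) f) = hardyENorm p f := by
  have hinv := hf.weightedCompOp p ψ.inverse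
  rw [mulOp_toMap_eq_weightedCompOp p, hardyENorm_weightedCompOp hp hp_top ψ hinv.coe_mul,
    hardyENorm_coe_mul hp hp_top hinv, hardyENorm_weightedCompOp hp hp_top _ hf]

lemma IsAnalytic.exists_mulOp_toMap_eq (hf : IsAnalytic f) (ψ : DiscAut) (h0 : f ψ.a = 0) :
    ∃ g, IsAnalytic g ∧ mulOp (fun z => (ψ.toMap z : ℂ)) g = f := by
  obtain ⟨F, hF, hfF⟩ := hf
  have ha : Metric.ball (0 : ℂ) 1 ∈ nhds (ψ.a : ℂ) :=
    Metric.isOpen_ball.mem_nhds (mem_ball_zero_iff.2 ψ.a.norm_lt_one)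
  let G : ℂ → ℂ := fun z => conj (ψ.lam : ℂ) * (1 - conj (ψ.a : ℂ) * z) * dslope F ψ.a z
  refine ⟨fun z => G z, ⟨G, ?_, fun _ => rfl⟩, funext fun z => ?_⟩
  · exact (by fun_prop : DifferentiableOn ℂ
      (fun z => conj (ψ.lam : ℂ) * (1 - conj (ψ.a : ℂ) * z)) (Metric.ball 0 1)).mul
        ((Complex.differentiableOn_dslope ha).2 hF)
  · have hslope : ((z : ℂ) - ψ.a) * dslope F ψ.a z = f z := by
      rw [← smul_eq_mul, sub_smul_dslope, ← hfF, ← hfF, h0, sub_zero]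
    have hd := ψ.denom_ne_zero z.norm_lt_one.le
    calc mulOp (fun z => (ψ.toMap z : ℂ)) (fun z => G z) z
        = conj (ψ.lam : ℂ) * ψ.lam * ((1 - conj (ψ.a : ℂ) * z) / (1 - conj (ψ.a : ℂ) * z)) *
            (((z : ℂ) - ψ.a) * dslope F ψ.a z) := by
          simp only [mulOp, DiscAut.coe_toMap, DiscAut.toFun, G]
          ring
      _ = f z := by rw [ψ.conj_lam_mul_lam, div_self hd, hslope, one_mul, one_mul]

end Operators

/-! ### The isometry `M_ψ U_φ` -/

section Isometry

variable {p : ℝ≥0∞} [hp : Fact (1 ≤ p)]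

lemma Hardy.ext {f g : Hardy p} (h : ∀ z, f z = g z) : f = g :=
  Subtype.ext (funext h)

lemma Hardy.isAnalytic (f : Hardy p) : IsAnalytic f := f.2.1

/-- The Hardy class function with underlying function `f`. -/
def Hardy.of (f : 𝔻 → ℂ) (hf : IsAnalytic f) (hfin : hardyENorm p f < ∞) : Hardy p :=
  ⟨f, hf, hfin⟩

lemma Hardy.coe_of {f : 𝔻 → ℂ} (hf : IsAnalytic f) (hfin : hardyENorm p f < ∞) :
    (Hardy.of f hf hfin : 𝔻 → ℂ) = f := rfl

/-- Evaluation at a point of the disc. -/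
def evalAt (b : 𝔻) : Hardy p →ₗ[ℂ] ℂ where
  toFun f := f b
  map_add' _ _ := rfl
  map_smul' _ _ := rfl

@[simp] lemma evalAt_apply (b : 𝔻) (f : Hardy p) : evalAt b f = f b := rfl

lemma hardyENorm_lt_top_of_bounded {f : 𝔻 → ℂ} {C : ℝ} (hC : ∀ z, ‖f z‖ ≤ C) (p : ℝ≥0∞) :
    hardyENorm p f < ∞ := by
  refine lt_of_le_of_lt (iSup_le fun r => ?_) (ENNReal.ofReal_lt_top (r := C))
  simpa [circleNorm] using eLpNorm_le_of_ae_bound (p := p) (μ := circleMeasure)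
    (.of_forall fun θ => hC (circlePt r θ))

lemma evalAt_surjective (b : 𝔻) : Function.Surjective (evalAt b : Hardy p →ₗ[ℂ] ℂ) := fun c =>
  ⟨.of (fun _ => c) ⟨fun _ => c, differentiableOn_const c, fun _ => rfl⟩
    (hardyENorm_lt_top_of_bounded (fun _ => le_rfl) p), rfl⟩

lemma isCodimOneIsometry_of_range_eq_ker {S : Hardy p →ₗᵢ[ℂ] Hardy p} {l : Hardy p →ₗ[ℂ] ℂ}
    (hl : Function.Surjective l) (h : LinearMap.range S.toLinearMap = LinearMap.ker l) :
    IsCodimOneIsometry S.toContinuousLinearMap := by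
  refine ⟨S.isometry, ?_⟩
  change Module.finrank ℂ (Hardy p ⧸ LinearMap.range S.toLinearMap) = 1
  rw [h, (l.quotKerEquivOfSurjective hl).finrank_eq, Module.finrank_self]

/-- The operator `M_ψ U_φ` on `H^p`. -/
def mulWeightedComp (hp_top : p ≠ ∞) (φ ψ : DiscAut) : Hardy p →ₗᵢ[ℂ] Hardy p where
  toFun f := .of (mulOp (fun z => (ψ.toMap z : ℂ)) (weightedCompOp p φ f))
    ((f.isAnalytic.weightedCompOp p φ).mulOp_toMap ψ) (by
      rw [hardyENorm_mulOp_toMap hp.out hp_top ψ (f.isAnalytic.weightedCompOp p φ),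
        hardyENorm_weightedCompOp hp.out hp_top φ f.isAnalytic]
      exact f.2.2)
  map_add' f g := Hardy.ext fun z => by
    change _ * (_ * (f _ + g _)) = _ * (_ * f _) + _ * (_ * g _)
    ring
  map_smul' c f := Hardy.ext fun z => by
    change _ * (_ * (c * f _)) = c * (_ * (_ * f _))
    ring
  norm_map' f := congrArg ENNReal.toReal <|
    (hardyENorm_mulOp_toMap hp.out hp_top ψ (f.isAnalytic.weightedCompOp p φ)).trans
      (hardyENorm_weightedCompOp hp.out hp_top φ f.isAnalytic)

variable (hp_top : p ≠ ∞) (φ ψ : DiscAut)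

lemma coe_mulWeightedComp (f : Hardy p) : (mulWeightedComp hp_top φ ψ f : 𝔻 → ℂ) =
    mulOp (fun z => (ψ.toMap z : ℂ)) (weightedCompOp p φ f) := rfl

lemma mulWeightedComp_apply (f : Hardy p) (z : 𝔻) : mulWeightedComp hp_top φ ψ f z =
    ψ.toFun z * (φ.weight p z * f (φ.toMap z)) := rfl

variable {ψ} in
theorem exists_mulWeightedComp_eq {f : Hardy p} (h0 : f ψ.a = 0) :
    ∃ g, mulWeightedComp hp_top φ ψ g = f := by
  obtain ⟨g, hg, hgf⟩ := f.isAnalytic.exists_mulOp_toMap_eq ψ h0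
  have hfin : hardyENorm p (weightedCompOp p φ.inverse g) < ∞ := by
    rw [hardyENorm_weightedCompOp hp.out hp_top _ hg, ← hardyENorm_mulOp_toMap hp.out hp_top ψ hg,
      hgf]
    exact f.2.2
  refine ⟨.of _ (hg.weightedCompOp p φ.inverse) hfin, Hardy.ext fun z => ?_⟩
  rw [coe_mulWeightedComp, Hardy.coe_of, weightedCompOp_weightedCompOp_inverse, hgf]

theorem range_mulWeightedComp :
    LinearMap.range (mulWeightedComp hp_top φ ψ).toLinearMap = LinearMap.ker (evalAt ψ.a) := by
  ext f
  refine ⟨?_, fun h0 => exists_mulWeightedComp_eq hp_top φ h0⟩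
  rintro ⟨g, rfl⟩
  rw [LinearMap.mem_ker, evalAt_apply, LinearIsometry.coe_toLinearMap, mulWeightedComp_apply,
    DiscAut.toFun_a, zero_mul]

/-- Dividing `f` by `S = M_ψ U_φ` pushes its zero set forward by `φ`, except that the zero at
`ψ.a` is lost; as `ψ.a` is not periodic, it is never needed again. -/
theorem mem_range_mulWeightedComp_pow (hψ : ψ.a ∉ Function.periodicPts φ.toMap) {f : Hardy p}
    (hf : ∀ k z, φ.toMap^[k] z = ψ.a → f z = 0) (n : ℕ) :
    f ∈ Set.range (((mulWeightedComp hp_top φ ψ).toContinuousLinearMap ^ n :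
      Hardy p →L[ℂ] Hardy p)) := by
  induction n generalizing f with
  | zero => exact ⟨f, rfl⟩
  | succ n ih =>
    obtain ⟨g, rfl⟩ := exists_mulWeightedComp_eq hp_top φ (hf 0 ψ.a rfl)
    have hg (k z) (hz : φ.toMap^[k] z = ψ.a) : g z = 0 := by
      obtain ⟨w, rfl⟩ : ∃ w, φ.toMap w = z := ⟨_, φ.toMap_inverse z⟩
      have hw : ψ.toFun w ≠ 0 := fun h => hψ ⟨k + 1, k.succ_pos, by
        obtain rfl : w = ψ.a := ψ.toMap_injective (Complex.UnitDisc.coe_injective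
          (h.trans ψ.toFun_a.symm))
        exact hz⟩
      have h0 := hf (k + 1) w hz
      rw [mulWeightedComp_apply] at h0
      exact (mul_eq_zero.1 ((mul_eq_zero.1 h0).resolve_left hw)).resolve_left
        (φ.weight_ne_zero p w.norm_lt_one.le)
    obtain ⟨q, hq⟩ := ih hg
    refine ⟨q, ?_⟩
    rw [pow_succ', mul_apply_eq_comp, hq]
    rfl

end Isometry

/-! ### Hyperbolic automorphisms in the right half-plane -/

/-- The Möbius map of the disc onto the right half-plane sending the boundary points `α` and `β`
to `0` and `∞`. The subtracted constant is purely imaginary. -/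
def halfPlaneMap (α β z : ℂ) : ℂ :=
  herglotzRieszKernel 0 z β - herglotzRieszKernel 0 α β

section HalfPlaneMap

variable {α β : ℂ}

lemma halfPlaneMap_eq {z : ℂ} (hz : β ≠ z) (hαβ : α ≠ β) :
    halfPlaneMap α β z = 2 * β / (β - α) * ((z - α) / (β - z)) := by
  have hz' := sub_ne_zero.2 hz
  have hα := sub_ne_zero.2 hαβ.symm
  simp only [halfPlaneMap, herglotzRieszKernel_def, sub_zero]
  field_simp
  ring

lemma re_halfPlaneMap (hα : ‖α‖ = 1) (hβ : ‖β‖ = 1) (z : ℂ) :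
    (halfPlaneMap α β z).re = (herglotzRieszKernel 0 z β).re := by
  have h : (herglotzRieszKernel 0 α β).re = poissonKernel 0 α β :=
    (congrFun poissonKernel_eq_re_herglotzRieszKernel β).symm
  rw [halfPlaneMap, Complex.sub_re, h, poissonKernel_def]
  simp [hα, hβ]

lemma one_sub_norm_le_re_halfPlaneMap (hα : ‖α‖ = 1) (hβ : ‖β‖ = 1) (z : 𝔻) :
    1 - ‖(z : ℂ)‖ ≤ 2 * (halfPlaneMap α β z).re := by
  have hz := z.norm_lt_one
  have hle : (1 - ‖(z : ℂ)‖) / (1 + ‖(z : ℂ)‖) ≤ (halfPlaneMap α β z).re := by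
    simpa [re_halfPlaneMap hα hβ, herglotzRieszKernel_def] using
      le_re_herglotzRieszKernel (mem_sphere_zero_iff_norm.2 hβ) (mem_ball_zero_iff.2 hz)
  have hnn := norm_nonneg (z : ℂ)
  rw [div_le_iff₀ (by positivity)] at hle
  nlinarith

lemma differentiableOn_halfPlaneMap (α : ℂ) (hβ : ‖β‖ = 1) :
    DifferentiableOn ℂ (halfPlaneMap α β) (Metric.ball 0 1) := by
  have hne (z : ℂ) (hz : z ∈ Metric.ball (0 : ℂ) 1) : β - 0 - (z - 0) ≠ 0 := by
    rintro h
    obtain rfl : β = z := by simpa [sub_eq_zero] using h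
    simp [hβ] at hz
  exact (DifferentiableOn.div (by fun_prop) (by fun_prop) hne).sub_const _

end HalfPlaneMap

namespace DiscAut

variable {φ : DiscAut} {α β : ℂ}

lemma lam_mul_conj_denom_of_fixed (hα : ‖α‖ = 1) (hφα : φ.toFun α = α) :
    φ.lam * conj (1 - conj (φ.a : ℂ) * α) = 1 - conj (φ.a : ℂ) * α := by
  have hα0 : α ≠ 0 := norm_ne_zero_iff.1 (hα ▸ one_ne_zero)
  apply mul_left_cancel₀ hα0
  rw [mul_left_comm, mul_conj_one_sub_conj_mul hα]
  rwa [toFun, div_eq_iff (φ.denom_ne_zero hα.le)] at hφα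

lemma exists_pos_denom_eq_mul_of_fixed (hα : ‖α‖ = 1) (hβ : ‖β‖ = 1) (hφα : φ.toFun α = α)
    (hφβ : φ.toFun β = β) :
    ∃ μ : ℝ, 0 < μ ∧ 1 - conj (φ.a : ℂ) * β = μ * (1 - conj (φ.a : ℂ) * α) := by
  have hreal : conj ((1 - conj (φ.a : ℂ) * β) / (1 - conj (φ.a : ℂ) * α)) =
      (1 - conj (φ.a : ℂ) * β) / (1 - conj (φ.a : ℂ) * α) := by
    rw [map_div₀, ← mul_div_mul_left _ _ (Circle.coe_ne_zero φ.lam),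
      lam_mul_conj_denom_of_fixed hα hφα, lam_mul_conj_denom_of_fixed hβ hφβ]
  obtain ⟨μ, hμ⟩ := Complex.conj_eq_iff_real.1 hreal
  have heq : 1 - conj (φ.a : ℂ) * β = μ * (1 - conj (φ.a : ℂ) * α) := by
    rw [← hμ, div_mul_cancel₀ _ (φ.denom_ne_zero hα.le)]
  refine ⟨μ, ?_, heq⟩
  have hre := φ.re_denom_pos hβ.le
  rw [heq, Complex.re_ofReal_mul] at hre
  exact pos_of_mul_pos_left hre (φ.re_denom_pos hα.le).le

lemma toMap_eq_id_of_fixed (hα0 : α ≠ 0) (hαβ : α ≠ β) (hφα : φ.toFun α = α)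
    (h : 1 - conj (φ.a : ℂ) * β = 1 - conj (φ.a : ℂ) * α) : φ.toMap = id := by
  have ha : (φ.a : ℂ) = 0 := by
    by_contra hne
    exact hαβ.symm (mul_left_cancel₀ (by simpa using hne) (sub_right_injective h))
  have hlam : (φ.lam : ℂ) = 1 := by
    simp only [toFun, ha, map_zero, zero_mul, sub_zero, div_one] at hφα
    exact (mul_eq_right₀ hα0).1 hφα
  exact funext fun z => Complex.UnitDisc.coe_injective (by simp [toFun, ha, hlam])

lemma halfPlaneMap_toFun (hα : ‖α‖ = 1) (hβ : ‖β‖ = 1) (hαβ : α ≠ β) (hφα : φ.toFun α = α)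
    (hφβ : φ.toFun β = β) {μ : ℂ}
    (hμ : 1 - conj (φ.a : ℂ) * β = μ * (1 - conj (φ.a : ℂ) * α)) (z : 𝔻) :
    halfPlaneMap α β (φ.toFun z) = μ * halfPlaneMap α β z := by
  have hβz (w : 𝔻) : β ≠ w := fun h => w.norm_lt_one.ne (h ▸ hβ)
  have hz := z.norm_lt_one.le
  have hdz := φ.denom_ne_zero hz
  have hdα := φ.denom_ne_zero hα.le
  have hdβ := φ.denom_ne_zero hβ.le
  have haa := φ.one_sub_conj_a_mul_a_ne_zero
  have hlam := Circle.coe_ne_zero φ.lam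
  have hsub := sub_ne_zero.2 (hβz z)
  have hquot : (φ.toFun z - α) / (β - φ.toFun z) = μ * ((z - α) / (β - z)) := by
    have hμ' : μ = (1 - conj (φ.a : ℂ) * β) / (1 - conj (φ.a : ℂ) * α) := by
      rw [hμ, mul_div_cancel_right₀ _ hdα]
    calc (φ.toFun z - α) / (β - φ.toFun z)
        = (φ.toFun z - φ.toFun α) / (φ.toFun β - φ.toFun z) := by rw [hφα, hφβ]
      _ = μ * ((z - α) / (β - z)) := by
        rw [φ.toFun_sub_toFun hz hα.le, φ.toFun_sub_toFun hβ.le hz, hμ']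
        field_simp
  rw [halfPlaneMap_eq (hβz z) hαβ, ← φ.coe_toMap, halfPlaneMap_eq (hβz _) hαβ, φ.coe_toMap, hquot,
    mul_left_comm]

/-- `h` carries the disc into the right half-plane and conjugates `φ` to the contraction
`w ↦ μ * w`. Positivity of `Re h` is recorded in a quantitative form, so that `Re h` also controls
the distance to the circle. -/
structure IsHalfPlaneModel (φ : DiscAut) (h : ℂ → ℂ) (μ : ℝ) : Prop where
  differentiableOn : DifferentiableOn ℂ h (Metric.ball 0 1)
  one_sub_norm_le (z : 𝔻) : 1 - ‖(z : ℂ)‖ ≤ 2 * (h z).re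
  map_toMap (z : 𝔻) : h (φ.toMap z) = μ * h z
  pos : 0 < μ
  lt_one : μ < 1

theorem IsHyperbolic.exists_isHalfPlaneModel (hφ : φ.IsHyperbolic) :
    ∃ h μ, φ.IsHalfPlaneModel h μ := by
  obtain ⟨hid, α, β, hα, hβ, hαβ, hφα, hφβ⟩ := hφ
  obtain ⟨μ, hμ0, hμ⟩ := exists_pos_denom_eq_mul_of_fixed hα hβ hφα hφβ
  rcases lt_trichotomy μ 1 with hlt | rfl | hgt
  · exact ⟨halfPlaneMap α β, μ, differentiableOn_halfPlaneMap α hβ,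
      one_sub_norm_le_re_halfPlaneMap hα hβ, halfPlaneMap_toFun hα hβ hαβ hφα hφβ hμ, hμ0, hlt⟩
  · rw [Complex.ofReal_one, one_mul] at hμ
    exact absurd (toMap_eq_id_of_fixed (norm_ne_zero_iff.1 (hα ▸ one_ne_zero)) hαβ hφα hμ) hid
  · have hμ' : 1 - conj (φ.a : ℂ) * α = (μ⁻¹ : ℝ) * (1 - conj (φ.a : ℂ) * β) := by
      rw [hμ, ← mul_assoc, ← Complex.ofReal_mul, inv_mul_cancel₀ hμ0.ne', Complex.ofReal_one,
        one_mul]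
    exact ⟨halfPlaneMap β α, μ⁻¹, differentiableOn_halfPlaneMap β hα,
      one_sub_norm_le_re_halfPlaneMap hβ hα, halfPlaneMap_toFun hβ hα hαβ.symm hφβ hφα hμ',
      inv_pos.2 hμ0, inv_lt_one_of_one_lt₀ hgt⟩

end DiscAut

/-- The power `w ^ (2πi / log μ)`, which is invariant under the dilation `w ↦ μ * w`. -/
def logPeriodic (μ : ℝ) (w : ℂ) : ℂ :=
  w ^ (2 * Real.pi * Complex.I / Real.log μ)

lemma logPeriodic_mul {μ : ℝ} (hμ0 : 0 < μ) (hμ1 : μ ≠ 1) {w : ℂ} (hw : w ≠ 0) :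
    logPeriodic μ (μ * w) = logPeriodic μ w := by
  have hμ : (μ : ℂ) ≠ 0 := Complex.ofReal_ne_zero.2 hμ0.ne'
  have hlog : (Real.log μ : ℂ) ≠ 0 :=
    Complex.ofReal_ne_zero.2 (Real.log_ne_zero_of_pos_of_ne_one hμ0 hμ1)
  rw [logPeriodic, logPeriodic, Complex.cpow_def_of_ne_zero (mul_ne_zero hμ hw),
    Complex.cpow_def_of_ne_zero hw, Complex.log_ofReal_mul hμ0 hw, add_mul,
    mul_div_cancel₀ _ hlog, add_comm, Complex.exp_periodic]

lemma norm_logPeriodic_le (μ : ℝ) {w : ℂ} (hw : w ≠ 0) :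
    ‖logPeriodic μ w‖ ≤ Real.exp (Real.pi * |2 * Real.pi / Real.log μ|) := by
  have hexp : 2 * Real.pi * Complex.I / Real.log μ =
      ((2 * Real.pi / Real.log μ : ℝ) : ℂ) * Complex.I := by
    push_cast
    ring
  rw [logPeriodic, hexp, Complex.norm_cpow_of_ne_zero hw, Complex.re_ofReal_mul, Complex.I_re,
    mul_zero, Real.rpow_zero, Complex.im_ofReal_mul, Complex.I_im, mul_one, one_div, ← Real.exp_neg]
  refine Real.exp_le_exp.2 ((neg_le_abs _).trans ?_)
  rw [abs_mul]
  gcongr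
  exact Complex.abs_arg_le_pi w

namespace DiscAut.IsHalfPlaneModel

variable {φ : DiscAut} {h : ℂ → ℂ} {μ : ℝ} (hh : φ.IsHalfPlaneModel h μ)
include hh

lemma re_pos (z : 𝔻) : 0 < (h z).re := by
  linarith [hh.one_sub_norm_le z, z.norm_lt_one]

lemma ne_zero (z : 𝔻) : h z ≠ 0 := fun h0 => (hh.re_pos z).ne' (by rw [h0, Complex.zero_re])

lemma map_iterate (n : ℕ) (z : 𝔻) : h (φ.toMap^[n] z) = (μ ^ n : ℝ) * h z := by
  induction n with
  | zero => simp
  | succ n ih =>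
    rw [Function.iterate_succ_apply', hh.map_toMap, ih, ← mul_assoc, ← Complex.ofReal_mul,
      pow_succ']

lemma notMem_periodicPts (z : 𝔻) : z ∉ Function.periodicPts φ.toMap := by
  rintro ⟨n, hn, hz⟩
  have heq := hh.map_iterate n z
  rw [hz.eq, eq_comm, mul_eq_right₀ (hh.ne_zero z), Complex.ofReal_eq_one] at heq
  exact (pow_lt_one₀ hh.pos.le hh.lt_one hn.ne').ne heq

theorem summable_one_sub_norm_iterate (c : 𝔻) :
    Summable fun n : ℕ => 1 - ‖((φ.toMap^[n] c : 𝔻) : ℂ)‖ := by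
  refine .of_nonneg_of_le (fun n => sub_nonneg.2 (φ.toMap^[n] c).norm_lt_one.le)
    (fun n => hh.one_sub_norm_le _) (.mul_left 2 ?_)
  simpa only [hh.map_iterate, Complex.re_ofReal_mul] using
    (summable_geometric_of_lt_one hh.pos.le hh.lt_one).mul_right (h c).re

lemma hasDerivAt_logPeriodic (z : 𝔻) :
    HasDerivAt (fun w => logPeriodic μ (h w)) (2 * Real.pi * Complex.I / Real.log μ *
      h z ^ (2 * Real.pi * Complex.I / Real.log μ - 1 : ℂ) * deriv h z) z := by
  have hz : Metric.ball (0 : ℂ) 1 ∈ nhds (z : ℂ) :=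
    Metric.isOpen_ball.mem_nhds (mem_ball_zero_iff.2 z.norm_lt_one)
  exact (hh.differentiableOn.differentiableAt hz).hasDerivAt.cpow_const
    (Complex.mem_slitPlane_iff.2 (.inl (hh.re_pos z)))

lemma exists_logPeriodic_ne (b : 𝔻) : ∃ z : 𝔻, logPeriodic μ (h z) ≠ logPeriodic μ (h b) := by
  by_contra! hconst
  have hderiv : (Metric.ball (0 : ℂ) 1).EqOn (deriv h) 0 := fun z hz => by
    have hd := hh.hasDerivAt_logPeriodic (.mk z (mem_ball_zero_iff.1 hz))
    have hlocal : (fun w => logPeriodic μ (h w)) =ᶠ[nhds z] fun _ => logPeriodic μ (h b) := by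
      filter_upwards [Metric.isOpen_ball.mem_nhds hz] with w hw
      exact hconst (.mk w (mem_ball_zero_iff.1 hw))
    have hzero := hd.unique ((hasDerivAt_const z _).congr_of_eventuallyEq hlocal)
    have hlog : (Real.log μ : ℂ) ≠ 0 := Complex.ofReal_ne_zero.2 (Real.log_neg hh.pos hh.lt_one).ne
    refine (mul_eq_zero.1 hzero).resolve_left
      (mul_ne_zero (div_ne_zero (by simp) hlog) fun h0 => ?_)
    exact hh.ne_zero _ ((Complex.cpow_eq_zero_iff _ _).1 h0).1
  obtain ⟨c, hc⟩ := Metric.isOpen_ball.exists_is_const_of_deriv_eq_zero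
    (convex_ball (0 : ℂ) 1).isPreconnected hh.differentiableOn hderiv
  have hfix := hh.map_toMap 0
  rw [hc _ (mem_ball_zero_iff.2 (φ.toMap 0).norm_lt_one),
    ← hc _ (mem_ball_zero_iff.2 (0 : 𝔻).norm_lt_one), eq_comm, mul_eq_right₀ (hh.ne_zero 0),
    Complex.ofReal_eq_one] at hfix
  exact hh.lt_one.ne hfix

theorem exists_hardy_vanishing_on_backward_orbit (p : ℝ≥0∞) [Fact (1 ≤ p)] (b : 𝔻) :
    ∃ f : Hardy p, f ≠ 0 ∧ ∀ k z, φ.toMap^[k] z = b → f z = 0 := by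
  let g : ℂ → ℂ := fun z => logPeriodic μ (h z) - logPeriodic μ (h b)
  have hg : IsAnalytic fun z => g z :=
    ⟨g, fun z hz => ((hh.hasDerivAt_logPeriodic (.mk z (mem_ball_zero_iff.1 hz))).sub_const
      _).differentiableAt.differentiableWithinAt, fun _ => rfl⟩
  have hbound (z : 𝔻) := (norm_sub_le _ _).trans
    (add_le_add (norm_logPeriodic_le μ (hh.ne_zero z)) (norm_logPeriodic_le μ (hh.ne_zero b)))
  have hinv : Function.Semiconj (fun z : 𝔻 => logPeriodic μ (h z)) φ.toMap id :=
    fun z => (congrArg (logPeriodic μ) (hh.map_toMap z)).trans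
      (logPeriodic_mul hh.pos hh.lt_one.ne (hh.ne_zero z))
  refine ⟨.of _ hg (hardyENorm_lt_top_of_bounded hbound p), fun h0 => ?_, fun k z hz => ?_⟩
  · obtain ⟨z, hz⟩ := hh.exists_logPeriodic_ne b
    exact hz (sub_eq_zero.1 (congrArg (evalAt z) h0))
  · have hk := hinv.iterate_right k z
    rw [Function.iterate_id, id, hz] at hk
    exact sub_eq_zero.2 hk.symm

end DiscAut.IsHalfPlaneModel

end HardyDisc

end

theorem proposition4_general (p : ℝ≥0∞) [Fact (1 ≤ p)] (hp_top : p ≠ ∞) (φ ψ : DiscAut)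
    (hφ : φ.IsHyperbolic) :
    (∀ c : 𝔻, Summable fun n : ℕ => 1 - ‖((φ.toMap^[n] c : 𝔻) : ℂ)‖) ∧
    ∃ S : Hardy p →L[ℂ] Hardy p,
      (∀ f : Hardy p,
        (S f : 𝔻 → ℂ) = mulOp (fun z => (ψ.toMap z : ℂ)) (weightedCompOp p φ f)) ∧
      IsCodimOneIsometry S ∧ ¬ IsCrownover S := by
  obtain ⟨h, μ, hh⟩ := hφ.exists_isHalfPlaneModel
  refine ⟨hh.summable_one_sub_norm_iterate,
    (mulWeightedComp hp_top φ ψ).toContinuousLinearMap, coe_mulWeightedComp hp_top φ ψ,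
    isCodimOneIsometry_of_range_eq_ker (evalAt_surjective ψ.a) (range_mulWeightedComp hp_top φ ψ),
    fun hcrown => ?_⟩
  obtain ⟨f, hf0, hf⟩ := hh.exists_hardy_vanishing_on_backward_orbit p ψ.a
  have hmem := Set.mem_iInter₂.2 fun n (_ : 1 ≤ n) =>
    mem_range_mulWeightedComp_pow hp_top φ ψ (hh.notMem_periodicPts ψ.a) hf n
  exact hf0 (hcrown.2.subset hmem)

theorem proposition4 (p : ℝ≥0∞) [Fact (1 ≤ p)] (hp_top : p ≠ ∞) (hp_two : p ≠ 2)
    (φ ψ : DiscAut) (hφ : φ.IsHyperbolic) :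
    (∀ c : 𝔻, Summable fun n : ℕ => 1 - ‖((φ.toMap^[n] c : 𝔻) : ℂ)‖) ∧
    ∃ S : Hardy p →L[ℂ] Hardy p,
      (∀ f : Hardy p,
        (S f : 𝔻 → ℂ) = mulOp (fun z => (ψ.toMap z : ℂ)) (weightedCompOp p φ f)) ∧
      IsCodimOneIsometry S ∧ ¬ IsCrownover S :=
  proposition4_general p hp_top φ ψ hφ
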